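/- Let $K$ be a field of characteristic zero. A sequence $(a_n)_{n\ge 0}$ in $K$ is called \emph{holonomic of order $r$} if there are polynomials $p_0,\dots,p_r\in K[x]$ with $p_r\neq 0$ such that \[ p_r(n)a_{n+r}+p_{r-1}(n)a_{n+r-1}+\dots+p_0(n)a_n=0 \] for every integer $n\ge 0$ that exceeds all non-negative integer roots of $p_r$ (so for all $n\ge 0$ if $p_r(n)\ne 0$ for $n=0,1,2,\dots$, and for all $n>n_0$ if $n_0$ is the largest non-negative integer root of $p_r$). A formal power series $f\in K[[x]]$ satisfies a homogeneous differential equation of order $r$ if there are polynomials $q_0,\dots,q_r\in K[x]$ with $q_r\ne 0$ such that $q_0f+q_1f'+\dots+q_rf^{(r)}=0$. \textbf{Theorem.} Assume that $(a_n)$ and $(b_n)$ are holonomic sequences of orders $r$ and $s$, respectively. Then the following sequences are also holonomic, with the specified upper bound on the order: (i) addition: $(a_n+b_n)_{n\ge 0}$, of order at most $r+s$; (ii) term-wise multiplication: $(a_n b_n)_{n\ge 0}$, of order at most $rs$; (iii) partial sum: $\left(\sum_{i=0}^n a_i\right)_{n\ge 0}$, of order at most $r+1$; (iv) linear subsequence: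 $(a_{mn})_{n\ge 0}$, for every positive integer $m$, of order at most $r$. Furthermore, let $c_n=\sum_{i=0}^n a_i b_{n-i}$ be the Cauchy product of $(a_n)$ and $(b_n)$. If the generating functions $A(x)=\sum_{n\ge0} a_nx^n$ and $B(x)=\sum_{n\ge0} b_nx^n$ satisfy homogeneous differential equations of orders $r_1$ and $r_2$, respectively, then the generating function $\sum_{n\ge0} c_nx^n$ satisfies a homogeneous differential equation of order at most $r_1r_2$. -/

import Mathlib

open Polynomial PowerSeries

/-- `a` is a holonomic sequence of order `r`: there are polynomials `p 0, …, p r` with `p r` not the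
zero polynomial such that
`p r (n) * a (n + r) + ⋯ + p 1 (n) * a (n + 1) + p 0 (n) * a n = 0`
for every natural number `n` that exceeds all natural-number roots of `p r`.
If `p r (n) ≠ 0` for all `n = 0, 1, 2, …`, this is the recurrence for all `n ≥ 0`; otherwise it is
the recurrence for all `n > n₀`, with `n₀` the largest natural-number root of `p r`. -/
def IsHolonomic {K : Type*} [Field K] (a : ℕ → K) (r : ℕ) : Prop :=
  ∃ p : ℕ → K[X], p r ≠ 0 ∧
    ∀ n : ℕ, (∀ m : ℕ, (p r).eval (m : K) = 0 → m < n) →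
      ∑ i ∈ Finset.range (r + 1), (p i).eval (n : K) * a (n + i) = 0

/-- The formal power series `f` satisfies a homogeneous linear differential equation of order `r`
with polynomial coefficients, `q 0 * f + q 1 * f' + ⋯ + q r * f^(r) = 0` with `q r ≠ 0`. -/
def SatisfiesHomogeneousODE {K : Type*} [Field K] (f : K⟦X⟧) (r : ℕ) : Prop :=
  ∃ q : ℕ → K[X], q r ≠ 0 ∧
    ∑ i ∈ Finset.range (r + 1), (q i : K⟦X⟧) * (PowerSeries.derivative K)^[i] f = 0

/-! ### Linear algebra over the fraction field, with denominators cleared -/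

section RatSpan

variable {R M : Type*} [CommRing R] [CommRing M] {φ : R →+* M}
  {ι κ : Type*} [Fintype ι] [Fintype κ]

/-! Modulo denominators, order `r` means that all shifts (or derivatives) lie in the span of the
first `r`. Sums and products then have all shifts in spans of `r + s` and `r * s` elements, and `d +
1` elements in the span of `d` are dependent (`exists_relation_of_inRatSpan`). Polynomial values may
vanish, so rational functions do not act on sequences; `InRatSpan` clears denominators instead.
`InRatSpan.stable` treats shift and derivative together. Partial sums get an explicit recurrence. -/

/-- `f` lies in the span of the family `g` after multiplication by some nonzero scalar of `R`,
where `R` acts on `M` through `φ`. -/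
def InRatSpan (φ : R →+* M) (g : ι → M) (f : M) : Prop :=
  ∃ c : R, c ≠ 0 ∧ ∃ m : ι → R, φ c * f = ∑ j, φ (m j) * g j

namespace InRatSpan

theorem smul {g : ι → M} {u : M} (c : R) (hu : InRatSpan φ g u) : InRatSpan φ g (φ c * u) := by
  obtain ⟨d, hd, k, hk⟩ := hu
  refine ⟨d, hd, fun j => c * k j, ?_⟩
  rw [mul_left_comm, hk, Finset.mul_sum]
  refine Finset.sum_congr rfl fun j _ => ?_
  rw [map_mul, mul_assoc]

theorem map {g : ι → M} {u : M} (T : M →+* M) (τ : R →+* R) (hτ : Function.Injective τ)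
    (hT : ∀ c, T (φ c) = φ (τ c)) (hu : InRatSpan φ g u) :
    InRatSpan φ (fun i => T (g i)) (T u) := by
  obtain ⟨c, hc, m, hm⟩ := hu
  refine ⟨τ c, (map_ne_zero_iff τ hτ).2 hc, fun j => τ (m j), ?_⟩
  simpa only [map_mul, map_sum, hT] using congrArg T hm

variable [IsDomain R]

theorem of_mem (g : ι → M) (i : ι) : InRatSpan φ g (g i) := by
  classical
  refine ⟨1, one_ne_zero, Pi.single i 1, ?_⟩
  rw [Finset.sum_eq_single i]
  · simp
  · intro j _ hj
    simp [Pi.single_eq_of_ne hj]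
  · simp

theorem zero (g : ι → M) : InRatSpan φ g 0 :=
  ⟨1, one_ne_zero, 0, by simp⟩

theorem add {g : ι → M} {u v : M} (hu : InRatSpan φ g u) (hv : InRatSpan φ g v) :
    InRatSpan φ g (u + v) := by
  obtain ⟨c, hc, m, hm⟩ := hu
  obtain ⟨d, hd, k, hk⟩ := hv
  refine ⟨c * d, mul_ne_zero hc hd, fun j => d * m j + c * k j, ?_⟩
  have : φ (c * d) * (u + v) = φ d * (φ c * u) + φ c * (φ d * v) := by
    rw [map_mul]; ring
  rw [this, hm, hk, Finset.mul_sum, Finset.mul_sum, ← Finset.sum_add_distrib]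
  refine Finset.sum_congr rfl fun j _ => ?_
  simp only [map_add, map_mul]; ring

theorem sum {α : Type*} {g : ι → M} (s : Finset α) {u : α → M}
    (hu : ∀ i ∈ s, InRatSpan φ g (u i)) : InRatSpan φ g (∑ i ∈ s, u i) :=
  Finset.sum_induction u (InRatSpan φ g) (fun _ _ => add) (zero g) hu

theorem of_smul {g : ι → M} {u : M} {c : R} (hc : c ≠ 0) (hu : InRatSpan φ g (φ c * u)) :
    InRatSpan φ g u := by
  obtain ⟨d, hd, k, hk⟩ := hu
  exact ⟨d * c, mul_ne_zero hd hc, k, by rw [map_mul, mul_assoc, hk]⟩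

theorem trans {g : ι → M} {h : κ → M} {u : M} (hu : InRatSpan φ g u)
    (hg : ∀ i, InRatSpan φ h (g i)) : InRatSpan φ h u := by
  obtain ⟨c, hc, m, hm⟩ := hu
  exact of_smul hc (hm ▸ sum _ fun j _ => smul _ (hg j))

theorem mul {g : ι → M} {h : κ → M} {u v : M} (hu : InRatSpan φ g u) (hv : InRatSpan φ h v) :
    InRatSpan φ (fun x : ι × κ => g x.1 * h x.2) (u * v) := by
  obtain ⟨c, hc, m, hm⟩ := hu
  obtain ⟨d, hd, k, hk⟩ := hv
  refine ⟨c * d, mul_ne_zero hc hd, fun x => m x.1 * k x.2, ?_⟩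
  have : φ (c * d) * (u * v) = (φ c * u) * (φ d * v) := by
    rw [map_mul]; ring
  rw [this, hm, hk, Finset.sum_mul_sum, Fintype.sum_prod_type]
  refine Finset.sum_congr rfl fun i _ => Finset.sum_congr rfl fun j _ => ?_
  simp only [map_mul]; ring

/-- An operator satisfying a twisted Leibniz rule over `R` preserves the rational span of a family
as soon as it maps the family into it. -/
theorem stable {g : ι → M} {u : M} (D : M →+ M) (σ δ : R → R) (hσ : ∀ c, c ≠ 0 → σ c ≠ 0)
    (hD : ∀ c f, D (φ c * f) = φ (σ c) * D f + φ (δ c) * f)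
    (hg : ∀ i, InRatSpan φ g (D (g i))) (hu : InRatSpan φ g u) : InRatSpan φ g (D u) := by
  have hu' := hu
  obtain ⟨c, hc, m, hm⟩ := hu
  refine of_smul (hσ c hc) ?_
  -- Apply `D` to the relation for `u` and solve for `D u`; the leftover `δ c` term is a multiple of
  -- `u`.
  have h : φ (σ c) * D u = ∑ j, (φ (σ (m j)) * D (g j) + φ (δ (m j)) * g j) + φ (-δ c) * u := by
    have := congrArg D hm
    rw [hD, map_sum] at this
    simp only [hD] at this
    rw [← this, map_neg]; ring
  rw [h]
  exact (sum _ fun j _ => (smul _ (hg j)).add (smul _ (of_mem g j))).add (smul _ hu')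

theorem iterate_stable {g : ι → M} {u : M} (D : M →+ M) (σ δ : R → R)
    (hσ : ∀ c, c ≠ 0 → σ c ≠ 0)
    (hD : ∀ c f, D (φ c * f) = φ (σ c) * D f + φ (δ c) * f)
    (hg : ∀ i, InRatSpan φ g (D (g i))) (hu : InRatSpan φ g u) (n : ℕ) :
    InRatSpan φ g (D^[n] u) := by
  induction n with
  | zero => exact hu
  | succ n ih =>
    rw [Function.iterate_succ_apply']
    exact stable D σ δ hσ hD hg ih

end InRatSpan

variable [IsDomain R]

/-- Only `n = r` uses the relation, solved for its top term. This case covers `f` itself when `r =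
0` and the family is empty. -/
theorem inRatSpan_of_relation {D : M → M} {f : M} {r : ℕ} {p : ℕ → R} (hp : p r ≠ 0)
    (h : ∑ i ∈ Finset.range (r + 1), φ (p i) * D^[i] f = 0) {n : ℕ} (hn : n ≤ r) :
    InRatSpan φ (fun i : Fin r => D^[i] f) (D^[n] f) := by
  rcases hn.lt_or_eq with hn | rfl
  · exact InRatSpan.of_mem (fun i : Fin r => D^[i] f) ⟨n, hn⟩
  · refine ⟨p n, hp, fun i => -p i, ?_⟩
    rw [Finset.sum_range_succ, ← Fin.sum_univ_eq_sum_range (fun i => φ (p i) * D^[i] f)] at h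
    rw [eq_neg_of_add_eq_zero_right h, ← Finset.sum_neg_distrib]
    simp only [map_neg, neg_mul]

theorem inRatSpan_iterate_succ_of_relation {D : M → M} {f : M} {r : ℕ} {p : ℕ → R}
    (hp : p r ≠ 0) (h : ∑ i ∈ Finset.range (r + 1), φ (p i) * D^[i] f = 0) (i : Fin r) :
    InRatSpan φ (fun i : Fin r => D^[i] f) (D (D^[i] f)) := by
  rw [← Function.iterate_succ_apply' D]
  exact inRatSpan_of_relation hp h i.2

/-- A sequence in the rational span of `d` elements satisfies a linear relation of length at most
`d + 1` with nonzero last coefficient. -/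
theorem exists_relation_of_inRatSpan {g : ι → M} (u : ℕ → M) (hu : ∀ n, InRatSpan φ g (u n)) :
    ∃ t ≤ Fintype.card ι, ∃ p : ℕ → R, p t ≠ 0 ∧
      ∑ i ∈ Finset.range (t + 1), φ (p i) * u i = 0 := by
  classical
  choose c hc m hm using hu
  set d := Fintype.card ι with hd
  let L : (Fin (d + 1) → R) →ₗ[R] (ι → R) :=
    Matrix.vecMulLinear (Matrix.of fun (i : Fin (d + 1)) j => m i j)
  have hL : ¬ Function.Injective L := fun hinj => by
    have := card_le_of_injective R L hinj
    rw [Fintype.card_fin] at this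
    omega
  obtain ⟨v, hv, hv0⟩ : ∃ v, L v = 0 ∧ v ≠ 0 := by
    by_contra! hcon
    exact hL ((injective_iff_map_eq_zero L).2 hcon)
  -- The factor `c i` turns a dependence among the cleared `φ (c i) * u i` into one among the `u i`.
  let p : ℕ → R := fun i => if h : i < d + 1 then v ⟨i, h⟩ * c i else 0
  have hrel : ∑ i ∈ Finset.range (d + 1), φ (p i) * u i = 0 := by
    rw [← Fin.sum_univ_eq_sum_range (fun i => φ (p i) * u i)]
    have h1 : ∀ i : Fin (d + 1), φ (p i) * u i = ∑ j, φ (v i * m i j) * g j := fun i => by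
      simp only [p, i.2, dif_pos, map_mul, mul_assoc, hm, Finset.mul_sum]
    simp only [h1]
    rw [Finset.sum_comm]
    refine Finset.sum_eq_zero fun j _ => ?_
    rw [← Finset.sum_mul, ← map_sum]
    have : ∑ i, v i * m i j = L v j := rfl
    rw [this, hv]; simp
  obtain ⟨k, hk⟩ := Function.ne_iff.1 hv0
  have hne : ∃ i ≤ d, p i ≠ 0 :=
    ⟨k, Nat.lt_succ_iff.1 k.2, by
      simp only [p, k.2, dif_pos]
      exact mul_ne_zero hk (hc k)⟩
  obtain ⟨i, hi, hpi⟩ := hne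
  -- The coefficient at `d` may vanish, so cut at the last nonzero one.
  refine ⟨Nat.findGreatest (fun i => p i ≠ 0) d, Nat.findGreatest_le d, p,
    Nat.findGreatest_spec (P := fun i => p i ≠ 0) hi hpi, ?_⟩
  rw [← hrel]
  refine Finset.sum_subset (Finset.range_mono (Nat.succ_le_succ (Nat.findGreatest_le d))) ?_
  intro j hj hj'
  simp only [Finset.mem_range, not_lt] at hj hj'
  have : ¬ p j ≠ 0 :=
    Nat.findGreatest_is_greatest (P := fun i => p i ≠ 0) (Nat.lt_of_succ_le hj')
      (Nat.lt_succ_iff.1 hj)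
  rw [not_not.1 this]; simp

/-- Linear relations among the iterated derivatives of two elements yield one for their product. -/
theorem exists_relation_mul (D : M →+ M) (δ : R → R) (hD : ∀ u v, D (u * v) = u * D v + D u * v)
    (hδ : ∀ c, D (φ c) = φ (δ c)) {f g : M} {r s : ℕ} {p q : ℕ → R} (hp : p r ≠ 0) (hq : q s ≠ 0)
    (hf : ∑ i ∈ Finset.range (r + 1), φ (p i) * D^[i] f = 0)
    (hg : ∑ i ∈ Finset.range (s + 1), φ (q i) * D^[i] g = 0) :
    ∃ t ≤ r * s, ∃ w : ℕ → R, w t ≠ 0 ∧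
      ∑ i ∈ Finset.range (t + 1), φ (w i) * D^[i] (f * g) = 0 := by
  have hf' := inRatSpan_iterate_succ_of_relation hp hf
  have hg' := inRatSpan_iterate_succ_of_relation hq hg
  have h0 : InRatSpan φ (fun x : Fin r × Fin s => D^[x.1] f * D^[x.2] g) (f * g) :=
    (inRatSpan_of_relation hp hf (Nat.zero_le r)).mul
      (inRatSpan_of_relation hq hg (Nat.zero_le s))
  have hstable : ∀ x : Fin r × Fin s, InRatSpan φ
      (fun x : Fin r × Fin s => D^[x.1] f * D^[x.2] g) (D (D^[x.1] f * D^[x.2] g)) := fun x => by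
    rw [hD]
    exact ((InRatSpan.of_mem (fun i : Fin r => D^[i] f) x.1).mul (hg' x.2)).add
      ((hf' x.1).mul (InRatSpan.of_mem (fun i : Fin s => D^[i] g) x.2))
  have h := exists_relation_of_inRatSpan (fun n => D^[n] (f * g)) fun n =>
    h0.iterate_stable D id δ (fun _ hc => hc) (fun c u => by rw [hD, hδ, id]) hstable n
  rw [Fintype.card_prod, Fintype.card_fin, Fintype.card_fin] at h
  exact h

end RatSpan

/-! ### Holonomic sequences and the shift operator -/

section Holonomic

variable {K : Type*} [Field K]

/-- The sequence of values of a polynomial at the natural numbers. -/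
noncomputable def evalSeq (K : Type*) [Field K] : K[X] →+* (ℕ → K) :=
  RingHom.pi fun n : ℕ => Polynomial.evalRingHom (n : K)

@[simp] theorem evalSeq_apply (p : K[X]) (n : ℕ) : evalSeq K p n = p.eval (n : K) := rfl

/-- The subsequence of indices `m * n + k`. -/
def subSeq (K : Type*) [Field K] (m k : ℕ) : (ℕ → K) →+* (ℕ → K) :=
  RingHom.pi fun n : ℕ => Pi.evalRingHom (fun _ => K) (m * n + k)

@[simp] theorem subSeq_apply (m k : ℕ) (a : ℕ → K) (n : ℕ) :
    subSeq K m k a n = a (m * n + k) := rfl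

/-- Substitution of `m * X + k` in polynomials. -/
noncomputable def affineComp (K : Type*) [Field K] (m k : ℕ) : K[X] →+* K[X] :=
  Polynomial.compRingHom (Polynomial.C (m : K) * Polynomial.X + Polynomial.C (k : K))

theorem affineComp_injective [CharZero K] {m : ℕ} (hm : 0 < m) (k : ℕ) :
    Function.Injective (affineComp K m k) := by
  have hm' : (m : K) ≠ 0 := Nat.cast_ne_zero.2 hm.ne'
  rw [injective_iff_map_eq_zero]
  intro p hp
  have h : p.comp (Polynomial.C (m : K) * Polynomial.X + Polynomial.C (k : K)) = 0 := hp
  rcases Polynomial.comp_eq_zero_iff.1 h with h | ⟨-, h⟩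
  · exact h
  · have := congrArg (fun q => Polynomial.coeff q 1) h
    simp [hm'] at this

theorem subSeq_evalSeq (m k : ℕ) (p : K[X]) :
    subSeq K m k (evalSeq K p) = evalSeq K (affineComp K m k p) := by
  ext n
  simp [affineComp]

theorem iterate_shift (a : ℕ → K) (i n : ℕ) : (subSeq K 1 1)^[i] a n = a (n + i) := by
  induction i generalizing n with
  | zero => rfl
  | succ i ih =>
    rw [Function.iterate_succ_apply', subSeq_apply, ih]
    congr 1; ring

theorem relation_iff (a : ℕ → K) (r : ℕ) (p : ℕ → K[X]) :
    ∑ i ∈ Finset.range (r + 1), evalSeq K (p i) * (subSeq K 1 1)^[i] a = 0 ↔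
      ∀ n : ℕ, ∑ i ∈ Finset.range (r + 1), (p i).eval (n : K) * a (n + i) = 0 := by
  simp [funext_iff, iterate_shift]

/-- Multiplying the recurrence by a polynomial vanishing at `0, …, N`, with `N` bounding the natural
roots of `p r`, removes the exceptional indices at the same order. -/
theorem isHolonomic_iff [CharZero K] {a : ℕ → K} {r : ℕ} :
    IsHolonomic a r ↔ ∃ p : ℕ → K[X], p r ≠ 0 ∧
      ∑ i ∈ Finset.range (r + 1), evalSeq K (p i) * (subSeq K 1 1)^[i] a = 0 := by
  simp only [relation_iff]
  constructor
  · rintro ⟨p, hp, h⟩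
    have hfin : {m : ℕ | (p r).eval (m : K) = 0}.Finite :=
      ((Polynomial.finite_setOfPred_isRoot hp).preimage Nat.cast_injective.injOn)
    obtain ⟨N, hN⟩ := hfin.bddAbove
    let q : K[X] := ∏ i ∈ Finset.range (N + 1), (Polynomial.X - Polynomial.C (i : K))
    refine ⟨fun i => q * p i,
      mul_ne_zero (Finset.prod_ne_zero_iff.2 fun i _ => Polynomial.X_sub_C_ne_zero _) hp,
      fun n => ?_⟩
    simp only [Polynomial.eval_mul, mul_assoc, ← Finset.mul_sum]
    by_cases hn : n ≤ N
    · have : q.eval (n : K) = 0 := by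
        rw [Polynomial.eval_prod]
        exact Finset.prod_eq_zero (Finset.mem_range.2 (Nat.lt_succ_of_le hn)) (by simp)
      rw [this, zero_mul]
    · rw [h n fun m hm => (hN hm).trans_lt (not_le.1 hn), mul_zero]
  · rintro ⟨p, hp, h⟩
    exact ⟨p, hp, fun n _ => h n⟩

theorem exists_isHolonomic_of_inRatSpan [CharZero K] {ι : Type*} [Fintype ι] {g : ι → ℕ → K}
    {a : ℕ → K} (h : ∀ n, InRatSpan (evalSeq K) g ((subSeq K 1 1)^[n] a)) :
    ∃ t ≤ Fintype.card ι, IsHolonomic a t := by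
  obtain ⟨t, ht, p, hp, hrel⟩ := exists_relation_of_inRatSpan _ h
  exact ⟨t, ht, isHolonomic_iff.2 ⟨p, hp, hrel⟩⟩

theorem IsHolonomic.inRatSpan [CharZero K] {a : ℕ → K} {r : ℕ} (ha : IsHolonomic a r) (n : ℕ) :
    InRatSpan (evalSeq K) (fun i : Fin r => (subSeq K 1 1)^[i] a) ((subSeq K 1 1)^[n] a) := by
  obtain ⟨p, hp, h⟩ := isHolonomic_iff.1 ha
  refine InRatSpan.iterate_stable (subSeq K 1 1 : (ℕ → K) →+ (ℕ → K)) (affineComp K 1 1)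
    (fun _ => 0) (fun c hc => (map_ne_zero_iff _ (affineComp_injective one_pos 1)).2 hc)
    (fun c f => ?_) (inRatSpan_iterate_succ_of_relation hp h)
    (inRatSpan_of_relation hp h (Nat.zero_le r)) n
  simp [subSeq_evalSeq]

theorem IsHolonomic.add [CharZero K] {a b : ℕ → K} {r s : ℕ} (ha : IsHolonomic a r)
    (hb : IsHolonomic b s) : ∃ t ≤ r + s, IsHolonomic (fun n => a n + b n) t := by
  have h := exists_isHolonomic_of_inRatSpan (a := a + b)
    (g := Sum.elim (fun i : Fin r => (subSeq K 1 1)^[i] a) fun i : Fin s => (subSeq K 1 1)^[i] b)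
    fun n => by
      rw [iterate_map_add]
      exact ((ha.inRatSpan n).trans fun i => InRatSpan.of_mem (Sum.elim _ _) (Sum.inl i)).add
        ((hb.inRatSpan n).trans fun i => InRatSpan.of_mem (Sum.elim _ _) (Sum.inr i))
  rw [Fintype.card_sum, Fintype.card_fin, Fintype.card_fin] at h
  exact h

/-- The shift is a ring homomorphism, so each shifted product is a product of shifts. -/
theorem IsHolonomic.mul [CharZero K] {a b : ℕ → K} {r s : ℕ} (ha : IsHolonomic a r)
    (hb : IsHolonomic b s) : ∃ t ≤ r * s, IsHolonomic (fun n => a n * b n) t := by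
  have h := exists_isHolonomic_of_inRatSpan (a := a * b) fun n => by
    rw [iterate_map_mul]
    exact (ha.inRatSpan n).mul (hb.inRatSpan n)
  rw [Fintype.card_prod, Fintype.card_fin, Fintype.card_fin] at h
  exact h

theorem IsHolonomic.partialSum [CharZero K] {a : ℕ → K} {r : ℕ} (ha : IsHolonomic a r) :
    IsHolonomic (fun n => ∑ i ∈ Finset.range (n + 1), a i) (r + 1) := by
  simp only [isHolonomic_iff, relation_iff] at ha ⊢
  obtain ⟨p, hp, h⟩ := ha
  let q : ℕ → K[X] := fun i => affineComp K 1 1 (p i)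
  have hq : ∀ i (n : ℕ), (q i).eval (n : K) = (p i).eval ((n + 1 : ℕ) : K) := fun i n => by
    simp [q, affineComp]
  -- Coefficients of `∑ q i * (S (n+i+1) - S (n+i))`, the recurrence of `a` at `n + 1` written in
  -- partial sums `S`.
  refine ⟨fun i => (if i = 0 then 0 else q (i - 1)) - (if i = r + 1 then 0 else q i), ?_,
    fun n => ?_⟩
  · simpa using (map_ne_zero_iff _ (affineComp_injective one_pos 1)).2 hp
  · simp only [Polynomial.eval_sub, sub_mul, Finset.sum_sub_distrib]
    rw [Finset.sum_range_succ', Finset.sum_range_succ _ (r + 1)]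
    simp only [Nat.add_eq_zero_iff, one_ne_zero, and_false, if_false, Nat.add_sub_cancel, if_true,
      Polynomial.eval_zero, zero_mul, add_zero]
    rw [← Finset.sum_sub_distrib, ← h (n + 1)]
    refine Finset.sum_congr rfl fun i hi => ?_
    rw [if_neg (Finset.mem_range.1 hi).ne, ← mul_sub, hq]
    congr 1
    rw [show n + (i + 1) + 1 = n + i + 1 + 1 by ring, Finset.sum_range_succ _ (n + i + 1),
      add_sub_cancel_left]
    congr 1; ring

/-- Shifting the subsequence by `n` shifts `a` by `m * n`; restriction to multiples of `m` keeps the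
span on `r` generators. -/
theorem IsHolonomic.linearSubsequence [CharZero K] {a : ℕ → K} {r : ℕ} (ha : IsHolonomic a r)
    {m : ℕ} (hm : 0 < m) : ∃ t ≤ r, IsHolonomic (fun n => a (m * n)) t := by
  have h := exists_isHolonomic_of_inRatSpan (a := subSeq K m 0 a) fun n => by
    have h1 : (subSeq K 1 1)^[n] (subSeq K m 0 a) = subSeq K m 0 ((subSeq K 1 1)^[m * n] a) := by
      ext k
      simp only [iterate_shift, subSeq_apply]
      congr 1; ring
    rw [h1]
    exact (ha.inRatSpan (m * n)).map (subSeq K m 0) (affineComp K m 0)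
      (affineComp_injective hm 0) (subSeq_evalSeq m 0)
  rw [Fintype.card_fin] at h
  exact h

/-! ### Differential equations for power series -/

/-- The formal derivative as an additive map. -/
noncomputable def derivativeAddHom (K : Type*) [Field K] : K⟦X⟧ →+ K⟦X⟧ :=
  (PowerSeries.derivative K : K⟦X⟧ →ₗ[K] K⟦X⟧)

theorem derivativeAddHom_mul (u v : K⟦X⟧) :
    derivativeAddHom K (u * v) = u * derivativeAddHom K v + derivativeAddHom K u * v := by
  rw [mul_comm (derivativeAddHom K u)]
  exact (PowerSeries.derivative K).leibniz u v

theorem derivativeAddHom_coe (c : K[X]) :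
    derivativeAddHom K (Polynomial.coeToPowerSeries.ringHom c) =
      Polynomial.coeToPowerSeries.ringHom (Polynomial.derivative c) :=
  PowerSeries.derivative_coe c

theorem satisfiesHomogeneousODE_iff {f : K⟦X⟧} {r : ℕ} :
    SatisfiesHomogeneousODE f r ↔ ∃ q : ℕ → K[X], q r ≠ 0 ∧
      ∑ i ∈ Finset.range (r + 1),
        Polynomial.coeToPowerSeries.ringHom (q i) * (derivativeAddHom K)^[i] f = 0 :=
  Iff.rfl

theorem SatisfiesHomogeneousODE.mul {f g : K⟦X⟧} {r s : ℕ} (hf : SatisfiesHomogeneousODE f r)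
    (hg : SatisfiesHomogeneousODE g s) : ∃ t ≤ r * s, SatisfiesHomogeneousODE (f * g) t := by
  simp only [satisfiesHomogeneousODE_iff] at hf hg ⊢
  obtain ⟨p, hp, hf⟩ := hf
  obtain ⟨q, hq, hg⟩ := hg
  exact exists_relation_mul (derivativeAddHom K) _ derivativeAddHom_mul derivativeAddHom_coe
    hp hq hf hg

end Holonomic

theorem mainTheorem6 {K : Type*} [Field K] [CharZero K] (a b : ℕ → K) (r s : ℕ)
    (ha : IsHolonomic a r) (hb : IsHolonomic b s) :
    (∃ t ≤ r + s, IsHolonomic (fun n => a n + b n) t) ∧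
    (∃ t ≤ r * s, IsHolonomic (fun n => a n * b n) t) ∧
    (∃ t ≤ r + 1, IsHolonomic (fun n => ∑ i ∈ Finset.range (n + 1), a i) t) ∧
    (∀ m : ℕ, 0 < m → ∃ t ≤ r, IsHolonomic (fun n => a (m * n)) t) ∧
    (∀ r₁ r₂ : ℕ,
      SatisfiesHomogeneousODE (PowerSeries.mk a) r₁ →
      SatisfiesHomogeneousODE (PowerSeries.mk b) r₂ →
      ∃ t ≤ r₁ * r₂, SatisfiesHomogeneousODE
        (PowerSeries.mk fun n => ∑ i ∈ Finset.range (n + 1), a i * b (n - i)) t) := by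
  refine ⟨ha.add hb, ha.mul hb, ⟨r + 1, le_rfl, ha.partialSum⟩,
    fun m hm => ha.linearSubsequence hm, fun r₁ r₂ h₁ h₂ => ?_⟩
  have : (PowerSeries.mk fun n => ∑ i ∈ Finset.range (n + 1), a i * b (n - i)) =
      PowerSeries.mk a * PowerSeries.mk b := by
    ext n
    simp only [PowerSeries.coeff_mk, PowerSeries.coeff_mul,
      Finset.Nat.sum_antidiagonal_eq_sum_range_succ_mk]
  rw [this]
  exact h₁.mul h₂
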